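/- **Setting.** Let $\Omega\subset\mathbb{R}^{d_\xi}$ be compact, let $X$ be a real Banach space with a continuous linear embedding into $C^0(\Omega,\mathbb{R}^{d_x})$, and let $\mathcal{P}\subset\mathbb{R}^{d_\mu}$ be compact. For each $\mu\in\mathcal{P}$ let $F_\mu:X\to X$ be a discrete-time map (for instance the time-$\Delta t$ map of a semiflow) and $\mathcal{A}_\mu\subset X$ a compact set with $F_\mu(\mathcal{A}_\mu)\subset\mathcal{A}_\mu$. Put $\mathcal{A}=\{(\mu,x):\mu\in\mathcal{P},\,x\in\mathcal{A}_\mu\}\subset\mathcal{P}\times X$, with the metric of the norm $\|\mu\|+\|x\|_X$, and let $\mathcal{A}_X$ be the projection of $\mathcal{A}$ to $X$. Given sensor locations $\xi^{(1)},\dots,\xi^{(N_s)}\in\Omega$ and a linear map $\Pi:\mathbb{R}^{d_x}\to\mathbb{R}^{d_o}$, let $p=N_sd_o$, $h(x)=(\Pi x(\xi^{(1)}),\dots,\Pi x(\xi^{(N_s)}))\in\mathbb{R}^p$, and for an integer $k\ge 0$ let $$\Phi_k(\mu,x)=\bigl(h(x),h(F_\mu x),\dots,h(F_\mu^kx)\bigr)\in\mathbb{R}^{(k+1)p},\qquad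 Y=\Phi_k(\mathcal{A}).$$ Here $\dim_B$ denotes the (upper) box-counting dimension. **Theorem.** Let $k\ge 0$ and assume: (i) $\mathcal{A}$ is compact and $\dim_B(\mathcal{A})<\infty$; (ii) (stable delay observability) $\Phi_k$ is injective on $\mathcal{A}$, and there are constants $L_\Phi,L_\Psi>0$ such that $\Phi_k$ is $L_\Phi$-Lipschitz on $\mathcal{A}$ and its inverse $\Psi:Y\to\mathcal{A}$ is $L_\Psi$-Lipschitz; (iii) $(\mu,x)\mapsto F_\mu^kx$ is continuous from $\mathcal{A}$ to $X$. Let $T:Y\to C^0(\Omega,\mathbb{R}^{d_x})$ be the reconstruction operator $T(y)(\xi)=(F_\mu^kx)(\xi)$, where $(\mu,x)=\Psi(y)$. Then for every integer $d_z>2\dim_B(\mathcal{A}_X)$ there are a compact set $Z\subset\mathbb{R}^{d_z}$ and continuous maps $\mathcal{G}:Y\to Z$ and $\mathcal{F}:\Omega\times Z\to\mathbb{R}^{d_x}$ such that $$T(y)(\xi)=\mathcal{F}(\xi,\mathcal{G}(y))\qquad\text{for all } y\in Y,\ \xi\in\Omega.$$ Moreover, for every continuous non-polynomial activation function $\sigma:\mathbb{R}\to\mathbb{R}$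 and every $\varepsilon>0$ there are feedforward neural networks $\widehat{\mathcal{G}}:\mathbb{R}^{(k+1)p}\to\mathbb{R}^{d_z}$ and $\widehat{\mathcal{F}}:\mathbb{R}^{d_\xi}\times\mathbb{R}^{d_z}\to\mathbb{R}^{d_x}$ with one hidden layer and activation $\sigma$ such that $$\sup_{y\in Y}\|\mathcal{G}(y)-\widehat{\mathcal{G}}(y)\|<\varepsilon,\qquad \sup_{\xi\in\Omega,\,z\in Z}\|\mathcal{F}(\xi,z)-\widehat{\mathcal{F}}(\xi,z)\|<\varepsilon,$$ $$\sup_{y\in Y}\sup_{\xi\in\Omega}\bigl\|T(y)(\xi)-\widehat{\mathcal{F}}(\xi,\widehat{\mathcal{G}}(y))\bigr\|<\varepsilon.$$ -/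

import Mathlib

open Filter Topology Set
open scoped NNReal ENNReal

/-- The (upper) box-counting dimension `limsup_{ε → 0+} log N(ε, A) / log (1 / ε)`, where
`N(ε, A)` is the least number of closed `ε`-balls centred in `A` that cover `A`.
It equals the box-counting dimension whenever that limit exists; it is `⊥` for `A = ∅`. -/
noncomputable def boxDim {E : Type*} [PseudoEMetricSpace E] (A : Set E) : EReal :=
  limsup (fun ε : ℝ≥0 =>
    ENNReal.log ((Metric.coveringNumber ε A : ℕ∞) : ℝ≥0∞) / ((Real.log (1 / (ε : ℝ)) : ℝ) : EReal))
    (𝓝[>] 0)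

/-- `f` is a feedforward neural network with one hidden layer and activation `σ`: with weights
`w i`, biases `b i`, output weights `a i` and output bias `c`,
`f v = ∑ i, σ (w i v + b i) • a i + c`. -/
def IsNeuralNetwork {V W : Type*} [AddCommGroup V] [Module ℝ V] [AddCommGroup W] [Module ℝ W]
    (σ : ℝ → ℝ) (f : V → W) : Prop :=
  ∃ (n : ℕ) (w : Fin n → V →ₗ[ℝ] ℝ) (b : Fin n → ℝ) (a : Fin n → W) (c : W),
    ∀ v, f v = ∑ i, σ (w i v + b i) • a i + c

/-- Admissible activation functions: continuous and not a polynomial. -/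
def IsActivation (σ : ℝ → ℝ) : Prop :=
  Continuous σ ∧ ¬ ∃ p : Polynomial ℝ, ∀ t, σ t = p.eval t

/-- A parametric discrete-time dynamical system on a Banach space `X` of fields
`Ω → ℝ^dx`, with a compact parameter set `P ⊂ ℝ^dμ`, invariant sets `inv μ`, and point sensors.
Values of `F` and `inv` at parameters outside `P` are never used. -/
structure SensorSystem (dξ dx dμ Ns dₒ : ℕ) (X : Type*)
    [NormedAddCommGroup X] [NormedSpace ℝ X] where
  /-- the spatial domain -/
  Ω : Set (EuclideanSpace ℝ (Fin dξ))
  isCompact_Ω : IsCompact Ω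
  /-- the continuous embedding of `X` into `C⁰(Ω, ℝ^dx)` -/
  embed : X →L[ℝ] C(Ω, EuclideanSpace ℝ (Fin dx))
  embed_injective : Function.Injective embed
  /-- the parameter set -/
  P : Set (EuclideanSpace ℝ (Fin dμ))
  isCompact_P : IsCompact P
  /-- the discrete-time maps `F μ : X → X` -/
  F : EuclideanSpace ℝ (Fin dμ) → X → X
  /-- the compact forward-invariant sets -/
  inv : EuclideanSpace ℝ (Fin dμ) → Set X
  isCompact_inv : ∀ μ ∈ P, IsCompact (inv μ)
  mapsTo_inv : ∀ μ ∈ P, MapsTo (F μ) (inv μ) (inv μ)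
  /-- the sensor locations -/
  sensor : Fin Ns → Ω
  /-- the linear map that selects the observed channels -/
  proj : EuclideanSpace ℝ (Fin dx) →ₗ[ℝ] EuclideanSpace ℝ (Fin dₒ)

namespace SensorSystem

variable {dξ dx dμ Ns dₒ : ℕ} {X : Type*} [NormedAddCommGroup X] [NormedSpace ℝ X]

/-- The augmented states `(μ, x)`, with norm `‖μ‖ + ‖x‖`. -/
abbrev AugState (dμ : ℕ) (X : Type*) : Type _ := WithLp 1 (EuclideanSpace ℝ (Fin dμ) × X)

/-- The observation windows: `k + 1` measurements by `Ns` sensors of `dₒ` channels each. -/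
abbrev Window (Ns dₒ k : ℕ) : Type := EuclideanSpace ℝ (Fin (k + 1) × Fin Ns × Fin dₒ)

/-- The augmented invariant set `{(μ, x) | μ ∈ P, x ∈ inv μ}`. -/
def augSet (S : SensorSystem dξ dx dμ Ns dₒ X) : Set (AugState dμ X) :=
  {a | a.fst ∈ S.P ∧ a.snd ∈ S.inv a.fst}

/-- The projection of the augmented invariant set to `X`. -/
def stateSet (S : SensorSystem dξ dx dμ Ns dₒ X) : Set X :=
  (fun a : AugState dμ X => a.snd) '' S.augSet

/-- The end-of-window state `G_k (μ, x) = F_μ^k x`. -/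
def endState (S : SensorSystem dξ dx dμ Ns dₒ X) (k : ℕ) (a : AugState dμ X) : X :=
  (S.F a.fst)^[k] a.snd

/-- The point-sensor map `h x = (Π x(ξ⁽¹⁾), …, Π x(ξ⁽ᴺ⁾))`. -/
noncomputable def sensorMap (S : SensorSystem dξ dx dμ Ns dₒ X) (x : X) :
    EuclideanSpace ℝ (Fin Ns × Fin dₒ) :=
  WithLp.toLp 2 fun j => S.proj (S.embed x (S.sensor j.1)) j.2

/-- The delay map `Φ_k (μ, x) = (h x, h (F_μ x), …, h (F_μ^k x))`. -/
noncomputable def delayMap (S : SensorSystem dξ dx dμ Ns dₒ X) (k : ℕ) (a : AugState dμ X) :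
    Window Ns dₒ k :=
  WithLp.toLp 2 fun j => S.sensorMap (S.endState j.1 a) j.2

/-- The set `Y = Φ_k(𝒜)` of observation windows. -/
def windowSet (S : SensorSystem dξ dx dμ Ns dₒ X) (k : ℕ) : Set (Window Ns dₒ k) :=
  S.delayMap k '' S.augSet

/-- A right inverse `Ψ : Y → 𝒜` of `Φ_k : 𝒜 → Y`; it is the inverse when `Φ_k` is injective
on `𝒜`. -/
noncomputable def delayInverse (S : SensorSystem dξ dx dμ Ns dₒ X) (k : ℕ)
    (y : S.windowSet k) : S.augSet :=
  ⟨y.2.choose, y.2.choose_spec.1⟩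

theorem delayMap_delayInverse (S : SensorSystem dξ dx dμ Ns dₒ X) (k : ℕ) (y : S.windowSet k) :
    S.delayMap k (S.delayInverse k y) = y :=
  y.2.choose_spec.2

/-- Stable delay observability with lag `k`: `Φ_k` is injective on `𝒜`, and `Φ_k` and its inverse
`Ψ` are Lipschitz. -/
def StableDelayObservable (S : SensorSystem dξ dx dμ Ns dₒ X) (k : ℕ) : Prop :=
  ∃ LΦ > (0 : ℝ), ∃ LΨ > (0 : ℝ),
    InjOn (S.delayMap k) S.augSet ∧
    (∀ a ∈ S.augSet, ∀ a' ∈ S.augSet, ‖S.delayMap k a - S.delayMap k a'‖ ≤ LΦ * ‖a - a'‖) ∧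
    ∀ y y' : S.windowSet k,
      ‖(S.delayInverse k y : AugState dμ X) - S.delayInverse k y'‖ ≤
        LΨ * ‖(y : Window Ns dₒ k) - y'‖

/-- The reconstruction operator `T : Y → C⁰(Ω, ℝ^dx)`, `T y = F_μ^k x` for `(μ, x) = Ψ y`. -/
noncomputable def reconstruct (S : SensorSystem dξ dx dμ Ns dₒ X) (k : ℕ) (y : S.windowSet k) :
    C(S.Ω, EuclideanSpace ℝ (Fin dx)) :=
  S.embed (S.endState k (S.delayInverse k y))

end SensorSystem

/-!
The end state `F_μ^k x` of every window lies in the compact set `S.stateSet`, so the reconstruction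
factors through any continuous injection of that set into `ℝ^dz`: with `L` such an injection,
`G = L ∘ endState ∘ Ψ` and `D (ξ, z)` evaluates at `ξ` the point of `S.stateSet` over `z`. It is
continuous because a continuous injection of a compact space is a homeomorphism onto its image.
The theorem thus rests on an embedding theorem and on the universal approximation theorem.

*Embedding* (Mañé, `exists_continuousLinearMap_injOn`). If `2 * boxDim A < dim W` for a compact
`A`, a generic continuous linear map `X → W` is injective on `A`. The box dimension bounds the
Hausdorff dimension, so `dimH (A ×ˢ A) < dim W` (`dimH_prod_self_le`). For a functional `φ` and a
compact set of pairs `(x, y)` in `A ×ˢ A` on which `φ (x - y) ≠ 0`, the maps `L` that separate all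
these pairs form an open set. It is dense: `L + φ t` fails to separate some pair only if `t` lies
in the image of the set of pairs under the locally Lipschitz map `-L (x - y) / φ (x - y)`, and this
image, of Hausdorff dimension less than `dim W`, has dense complement in `W`. Countably many such
sets of pairs exhaust the off-diagonal pairs, and Baire's theorem applies.

*Approximation* (Leshno, Lin, Pinkus and Schocken, `exists_isNeuralNetwork`). Let `M` be the closed
span in `C(K, ℝ)` of the functions `σ ∘ (u + b)` with `u` linear and `b` constant. Convolving `σ`
with a bump function gives a smooth `f` whose ridge functions are still in `M`, and so are their
derivatives in the scale parameter `s` of `f (s * u + b)`; at `s = 0` these are the functions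
`f⁽ᵏ⁾(b) • u ^ k`. If `u ^ k ∉ M`, then `f⁽ᵏ⁾ = 0` for every bump function; all these `f` are
polynomials of degree less than `k`, and `σ`, their pointwise limit, is a polynomial too. Hence `M`
contains all powers `u ^ k`, therefore all `exp u`, whose span is an algebra to which the
Stone–Weierstrass theorem applies.

For the composed error the network for `D` is chosen first; it is uniformly continuous near
`Ω × Z`, which says how well `G` has to be approximated.
-/

/-! ### Box-counting and Hausdorff dimension -/

theorem boxDim_nonneg {E : Type*} [PseudoEMetricSpace E] {A : Set E} (hA : A.Nonempty) :
    0 ≤ boxDim A := by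
  have hev : ∀ᶠ ε : ℝ≥0 in 𝓝[>] 0, (0 : EReal) ≤
      ENNReal.log ((Metric.coveringNumber ε A : ℕ∞) : ℝ≥0∞) /
        ((Real.log (1 / (ε : ℝ)) : ℝ) : EReal) := by
    filter_upwards [Ioo_mem_nhdsGT (zero_lt_one (α := ℝ≥0))] with ε hε
    have hε0 : (0 : ℝ) < ε := hε.1
    have hε1 : (ε : ℝ) < 1 := hε.2
    refine EReal.div_nonneg ?_ (EReal.coe_nonneg.2 (Real.log_nonneg ?_))
    · rw [← ENNReal.log_one]
      refine ENNReal.log_monotone ?_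
      exact_mod_cast Order.one_le_iff_pos.2 (Metric.coveringNumber_pos_iff.2 hA)
    · rw [le_div_iff₀ hε0]; linarith
  exact le_limsup_of_frequently_le hev.frequently (by isBoundedDefault)

theorem eventually_coveringNumber_lt {E : Type*} [PseudoEMetricSpace E] {A : Set E} {c : ℝ}
    (hc : boxDim A < c) :
    ∀ᶠ ε : ℝ≥0 in 𝓝[>] 0,
      ((Metric.coveringNumber ε A : ℕ∞) : ℝ≥0∞) < ENNReal.ofReal ((ε : ℝ) ^ (-c)) := by
  filter_upwards [Filter.eventually_lt_of_limsup_lt hc (by isBoundedDefault),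
    Ioo_mem_nhdsGT (zero_lt_one (α := ℝ≥0))] with ε h hε
  have hε0 : (0 : ℝ) < ε := hε.1
  have hε1 : (ε : ℝ) < 1 := hε.2
  have hlog : 0 < Real.log (1 / (ε : ℝ)) := Real.log_pos (by rw [lt_div_iff₀ hε0]; linarith)
  rw [EReal.div_lt_iff (by exact_mod_cast hlog) (EReal.coe_ne_top _), ← EReal.coe_mul,
    ← EReal.log_exp ((c * Real.log (1 / (ε : ℝ)) : ℝ) : EReal), ENNReal.log_lt_log_iff,
    EReal.exp_coe] at h
  convert h using 2
  rw [Real.rpow_def_of_pos hε0, one_div, Real.log_inv]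
  congr 1; ring

/-- The products of the balls of a cover of `A` by `N ε` balls cover `A ×ˢ A` by `N ε ^ 2` sets
of diameter at most `2 * ε`, and `N ε ^ 2 * (2 * ε) ^ (2 * c) ≤ 2 ^ (2 * c)` for small `ε`. -/
theorem dimH_prod_self_le {E : Type*} [EMetricSpace E] {A : Set E} {c : ℝ≥0}
    (hc : boxDim A < ((c : ℝ) : EReal)) : dimH (A ×ˢ A) ≤ ((2 * c : ℝ≥0) : ℝ≥0∞) := by
  borelize (E × E)
  refine dimH_le_of_hausdorffMeasure_ne_top (ne_top_of_le_ne_top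
    (ENNReal.rpow_ne_top_of_nonneg (2 * c).coe_nonneg ENNReal.ofNat_ne_top :
      (2 : ℝ≥0∞) ^ ((2 * c : ℝ≥0) : ℝ) ≠ ⊤) ?_)
  have hN := eventually_coveringNumber_lt hc
  have hfin (ε : ℝ≥0) : Finite (Metric.minimalCover ε A) := Metric.finite_minimalCover
  let _ (ε : ℝ≥0) : Fintype (Metric.minimalCover ε A) := Fintype.ofFinite _
  let t (ε : ℝ≥0) (i : Metric.minimalCover ε A × Metric.minimalCover ε A) : Set (E × E) :=
    Metric.closedEBall (i.1 : E) ε ×ˢ Metric.closedEBall (i.2 : E) ε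
  have hdiam (ε : ℝ≥0) (i) : Metric.ediam (t ε i) ≤ 2 * ε := by
    refine (Metric.ediam_le fun p hp q hq => ?_)
    rw [Prod.edist_eq]
    refine max_le ?_ ?_
    · exact (Metric.edist_le_ediam_of_mem hp.1 hq.1).trans Metric.ediam_closedEBall_le
    · exact (Metric.edist_le_ediam_of_mem hp.2 hq.2).trans Metric.ediam_closedEBall_le
  have hr : Tendsto (fun ε : ℝ≥0 => 2 * (ε : ℝ≥0∞)) (𝓝[>] 0) (𝓝 0) := by
    have : Tendsto (fun ε : ℝ≥0 => ((2 * ε : ℝ≥0) : ℝ≥0∞)) (𝓝 0) (𝓝 ((2 * 0 : ℝ≥0) : ℝ≥0∞)) :=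
      ENNReal.tendsto_coe.2 (tendsto_const_nhds.mul tendsto_id)
    simpa using this.mono_left nhdsWithin_le_nhds
  refine (MeasureTheory.Measure.hausdorffMeasure_le_liminf_sum _ _ _ hr t
    (Eventually.of_forall fun ε i => hdiam ε i) ?_).trans ?_
  · filter_upwards [hN] with ε hε
    have hne : Metric.coveringNumber ε A ≠ ⊤ := by
      rintro h; simp [h] at hε
    have hcov := Metric.isCover_iff_subset_iUnion_closedEBall.1 (Metric.isCover_minimalCover hne)
    rintro ⟨x, y⟩ ⟨hx, hy⟩
    obtain ⟨a, ha, hxa⟩ := mem_iUnion₂.1 (hcov hx)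
    obtain ⟨b, hb, hyb⟩ := mem_iUnion₂.1 (hcov hy)
    exact mem_iUnion.2 ⟨(⟨a, ha⟩, ⟨b, hb⟩), hxa, hyb⟩
  · refine liminf_le_of_frequently_le' (Eventually.frequently ?_)
    filter_upwards [hN, self_mem_nhdsWithin] with ε hε hpos
    have hε0 : (0 : ℝ) < ε := hpos
    have hne : Metric.coveringNumber ε A ≠ ⊤ := by
      rintro h; simp [h] at hε
    have hcard : ((Fintype.card (Metric.minimalCover ε A) : ℕ) : ℝ≥0∞) =
        ((Metric.coveringNumber ε A : ℕ∞) : ℝ≥0∞) := by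
      rw [← Metric.encard_minimalCover hne, ← Nat.card_eq_fintype_card, Nat.card_coe_set_eq,
        ← (Metric.finite_minimalCover (A := A) (ε := ε)).cast_ncard_eq,
        ENat.toENNReal_coe]
    have hmul : ENNReal.ofReal ((ε : ℝ) ^ (-(c : ℝ))) * ENNReal.ofReal ((ε : ℝ) ^ (-(c : ℝ))) *
        (ε : ℝ≥0∞) ^ ((2 * c : ℝ≥0) : ℝ) = 1 := by
      rw [← ENNReal.ofReal_coe_nnreal, ENNReal.ofReal_rpow_of_pos hε0,
        ← ENNReal.ofReal_mul (by positivity), ← ENNReal.ofReal_mul (by positivity),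
        ← Real.rpow_add hε0, ← Real.rpow_add hε0]
      push_cast
      rw [show -(c : ℝ) + -c + 2 * c = 0 by ring]
      simp
    calc ∑ i, Metric.ediam (t ε i) ^ ((2 * c : ℝ≥0) : ℝ)
        ≤ ∑ _i : Metric.minimalCover ε A × Metric.minimalCover ε A,
            (2 * (ε : ℝ≥0∞)) ^ ((2 * c : ℝ≥0) : ℝ) :=
          Finset.sum_le_sum fun i _ => ENNReal.rpow_le_rpow (hdiam ε i) (2 * c).coe_nonneg
      _ = ((Metric.coveringNumber ε A : ℕ∞) : ℝ≥0∞) * ((Metric.coveringNumber ε A : ℕ∞) : ℝ≥0∞) *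
            (2 * (ε : ℝ≥0∞)) ^ ((2 * c : ℝ≥0) : ℝ) := by
          rw [Finset.sum_const, Finset.card_univ, Fintype.card_prod, nsmul_eq_mul, Nat.cast_mul,
            hcard]
      _ ≤ ENNReal.ofReal ((ε : ℝ) ^ (-(c : ℝ))) * ENNReal.ofReal ((ε : ℝ) ^ (-(c : ℝ))) *
            (2 * (ε : ℝ≥0∞)) ^ ((2 * c : ℝ≥0) : ℝ) := by gcongr
      _ = 2 ^ ((2 * c : ℝ≥0) : ℝ) := by
          rw [ENNReal.mul_rpow_of_nonneg _ _ (2 * c).coe_nonneg, mul_left_comm, hmul, mul_one]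

/-! ### Linear embeddings of compact sets -/

theorem isOpen_setOf_separating {X W : Type*} [NormedAddCommGroup X] [NormedSpace ℝ X]
    [NormedAddCommGroup W] [NormedSpace ℝ W] {K : Set (X × X)} (hK : IsCompact K) :
    IsOpen {L : X →L[ℝ] W | ∀ p ∈ K, L p.1 ≠ L p.2} := by
  refine isOpen_iff_eventually.2 fun L hL => hK.eventually_forall_of_forall_eventually fun p hp => ?_
  have h1 : Continuous fun q : (X →L[ℝ] W) × (X × X) => q.1 q.2.1 := by fun_prop
  have h2 : Continuous fun q : (X →L[ℝ] W) × (X × X) => q.1 q.2.2 := by fun_prop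
  exact (isOpen_ne_fun h1 h2).mem_nhds (hL p hp)

/-- The perturbation `L + φ t` of `L`, with `t : W` small, separates all pairs in `K` unless `t`
is in the image of `K` under a locally Lipschitz map; this image has empty interior by its Hausdorff
dimension. -/
theorem dense_setOf_separating {X W : Type*} [NormedAddCommGroup X] [NormedSpace ℝ X]
    [NormedAddCommGroup W] [NormedSpace ℝ W] [FiniteDimensional ℝ W] {K : Set (X × X)}
    (hK : IsCompact K) (hdim : dimH K < Module.finrank ℝ W) (φ : StrongDual ℝ X)
    (hφ : ∀ p ∈ K, φ (p.1 - p.2) ≠ 0) :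
    Dense {L : X →L[ℝ] W | ∀ p ∈ K, L p.1 ≠ L p.2} := by
  intro L
  -- `L + φ t` identifies the points of the pair `p` only if `t = bad p`
  let bad (p : X × X) : W := -((φ (p.1 - p.2))⁻¹ • L (p.1 - p.2))
  have hlip : LocallyLipschitzOn K bad := by
    intro p hp
    have : ContDiffAt ℝ 1 bad p := by
      have h0 : ContDiffAt ℝ 1 (fun p : X × X => φ (p.1 - p.2)) p := by fun_prop
      have h1 : ContDiffAt ℝ 1 (fun p : X × X => L (p.1 - p.2)) p := by fun_prop
      exact ((h0.inv (hφ p hp)).smul h1).neg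
    obtain ⟨C, t, ht, hC⟩ := this.exists_lipschitzOnWith
    exact ⟨C, t, mem_nhdsWithin_of_mem_nhds ht, hC⟩
  obtain ⟨C, hC⟩ := hlip.exists_lipschitzOnWith_of_compact hK
  have hdense : Dense (bad '' K)ᶜ :=
    dense_compl_of_dimH_lt_finrank (hC.dimH_image_le.trans_lt hdim)
  let pert : W → (X →L[ℝ] W) := fun t => L + φ.smulRight t
  have hpert : Continuous pert := by
    have : Continuous fun t : W => φ.smulRight t :=
      (ContinuousLinearMap.smulRightL ℝ X W φ).continuous
    exact continuous_const.add this
  have h0 : pert 0 = L := by simp [pert]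
  rw [← h0]
  refine map_mem_closure hpert (hdense 0) fun t ht p hp heq => ht ⟨p, hp, ?_⟩
  have h2 : φ (p.1 - p.2) • t = -L (p.1 - p.2) := by
    rw [eq_neg_iff_add_eq_zero, add_comm]
    have := sub_eq_zero.2 heq
    simp only [pert, add_apply, ContinuousLinearMap.smulRight_apply] at this
    rw [map_sub, map_sub, sub_smul, ← this]; abel
  simp only [bad]
  rw [← smul_neg, ← h2, smul_smul, inv_mul_cancel₀ (hφ p hp), one_smul]

/-- Mañé's embedding theorem. -/
theorem exists_continuousLinearMap_injOn {X W : Type*} [NormedAddCommGroup X] [NormedSpace ℝ X]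
    [NormedAddCommGroup W] [NormedSpace ℝ W] [FiniteDimensional ℝ W] {A : Set X}
    (hA : IsCompact A) (hdim : 2 * boxDim A < ((Module.finrank ℝ W : ℕ) : EReal)) :
    ∃ L : X →L[ℝ] W, InjOn L A := by
  rcases A.eq_empty_or_nonempty with rfl | hne
  · exact ⟨0, injOn_empty _⟩
  have h0 := boxDim_nonneg hne
  -- a strict inequality between the dimensions leaves room for a real exponent `c`
  have hdimH : dimH (A ×ˢ A) < Module.finrank ℝ W := by
    obtain ⟨d, hd⟩ : ∃ d : ℝ, boxDim A = d := by
      refine ⟨(boxDim A).toReal, (EReal.coe_toReal ?_ ?_).symm⟩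
      · intro h
        rw [h, EReal.mul_top_of_pos (by norm_num)] at hdim
        exact not_top_lt hdim
      · intro h
        simp [h] at h0
    rw [hd] at hdim h0
    have hd0 : 0 ≤ d := EReal.coe_nonneg.1 h0
    have hd2 : 2 * d < (Module.finrank ℝ W : ℝ) := by
      rwa [show (2 : EReal) = ((2 : ℝ) : EReal) from rfl, ← EReal.coe_mul,
        ← EReal.coe_natCast, EReal.coe_lt_coe_iff] at hdim
    obtain ⟨c, hc1, hc2⟩ := exists_between (show d < (Module.finrank ℝ W : ℝ) / 2 by linarith)
    lift c to ℝ≥0 using hd0.trans hc1.le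
    refine (dimH_prod_self_le (c := c) (by rw [hd]; exact_mod_cast hc1)).trans_lt ?_
    have : 2 * c < (Module.finrank ℝ W : ℝ≥0) := by
      rw [← NNReal.coe_lt_coe]; push_cast; linarith
    exact_mod_cast this
  have := isCompact_iff_compactSpace.1 hA
  -- the compact sets of pairs to be separated, and their relatively open parts, which cover the
  -- off-diagonal pairs and allow passing to a countable subfamily
  let U (i : StrongDual ℝ X × ℕ) : Set (A × A) :=
    {p | 1 / ((i.2 : ℝ) + 1) < |i.1 (p.1 - p.2)|}
  let K (i : StrongDual ℝ X × ℕ) : Set (X × X) :=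
    (A ×ˢ A) ∩ {p | 1 / ((i.2 : ℝ) + 1) ≤ |i.1 (p.1 - p.2)|}
  have hK (i) : IsCompact (K i) :=
    (hA.prod hA).inter_right (isClosed_le (by fun_prop) (by fun_prop))
  obtain ⟨T, hT, hTU⟩ := TopologicalSpace.isOpen_iUnion_countable U fun i =>
    isOpen_lt (by fun_prop) (by fun_prop)
  have hdense := dense_biInter_of_isOpen (X := X →L[ℝ] W)
    (f := fun i => {L | ∀ p ∈ K i, L p.1 ≠ L p.2}) (fun i _ => isOpen_setOf_separating (hK i)) hT
    (fun i _ => dense_setOf_separating (hK i)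
      ((dimH_mono inter_subset_left).trans_lt hdimH) i.1 fun p hp h => by
        have := hp.2
        rw [mem_ofPred_eq, h, abs_zero] at this
        exact absurd this (not_le.2 (by positivity)))
  obtain ⟨L, hL⟩ := hdense.nonempty
  refine ⟨L, fun x hx y hy hxy => by_contra fun hne => ?_⟩
  obtain ⟨φ, hφ⟩ := SeparatingDual.exists_ne_zero (R := ℝ) (sub_ne_zero.2 hne)
  obtain ⟨m, hm⟩ := exists_nat_one_div_lt (abs_pos.2 hφ)
  have hmem : ((⟨x, hx⟩, ⟨y, hy⟩) : A × A) ∈ ⋃ i ∈ T, U i := by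
    rw [hTU]
    exact mem_iUnion.2 ⟨(φ, m), hm⟩
  obtain ⟨i, hi, hiU⟩ := mem_iUnion₂.1 hmem
  have hle : 1 / ((i.2 : ℝ) + 1) ≤ |i.1 (x - y)| := le_of_lt hiU
  exact mem_iInter₂.1 hL i hi (x, y) ⟨⟨hx, hy⟩, hle⟩ hxy

/-! ### Smooth functions with a vanishing derivative and limits of polynomials -/

theorem exists_polynomial_of_iteratedDeriv_eq_zero (k : ℕ) {f : ℝ → ℝ} (hf : ContDiff ℝ (⊤ : ℕ∞) f)
    (h : ∀ x, iteratedDeriv k f x = 0) :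
    ∃ p ∈ Polynomial.degreeLT ℝ k, ∀ x, f x = p.eval x := by
  induction k generalizing f with
  | zero => exact ⟨0, Submodule.zero_mem _, fun x => by simpa using h x⟩
  | succ k ih =>
    have hf' : ContDiff ℝ (⊤ : ℕ∞) (deriv f) := (contDiff_infty_iff_deriv.1 hf).2
    obtain ⟨p, hp, hfp⟩ := ih hf' fun x => by rw [← iteratedDeriv_succ']; exact h x
    let q : Polynomial ℝ :=
      ∑ i ∈ Finset.range k, Polynomial.monomial (i + 1) (p.coeff i / ((i : ℝ) + 1))
    have hq : q.derivative = p := by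
      ext j
      simp only [q, Polynomial.derivative_sum, Polynomial.derivative_monomial,
        Polynomial.finsetSum_coeff, Polynomial.coeff_monomial]
      rw [Finset.sum_eq_single j]
      · have : (j : ℝ) + 1 ≠ 0 := by positivity
        simp [div_mul_cancel₀ _ this]
      · intro i _ hij
        simp [hij]
      · intro hj
        rw [Finset.mem_range, not_lt] at hj
        rw [Polynomial.coeff_eq_zero_of_degree_lt
          ((Polynomial.mem_degreeLT.1 hp).trans_le (by exact_mod_cast hj))]
        simp
    have hqdeg : q ∈ Polynomial.degreeLT ℝ (k + 1) := by
      refine Submodule.sum_mem _ fun i hi => Polynomial.mem_degreeLT.2 ?_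
      refine (Polynomial.degree_monomial_le _ _).trans_lt ?_
      exact_mod_cast Nat.succ_lt_succ (Finset.mem_range.1 hi)
    have hdiff : Differentiable ℝ f := hf.differentiable (by simp)
    have hconst := is_const_of_deriv_eq_zero (f := fun x => f x - q.eval x)
      (hdiff.sub q.differentiable) fun x => by
        rw [deriv_fun_sub (hdiff x) q.differentiableAt, Polynomial.deriv, hq, hfp, sub_self]
    refine ⟨q + Polynomial.C (f 0 - q.eval 0), Submodule.add_mem _ hqdeg ?_, fun x => ?_⟩
    · refine Polynomial.mem_degreeLT.2 (Polynomial.degree_C_le.trans_lt ?_)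
      exact_mod_cast k.succ_pos
    · have := hconst x 0
      rw [Polynomial.eval_add, Polynomial.eval_C, ← this]; ring

/-- Polynomial functions of degree less than `k` form a finite-dimensional subspace of `ℝ → ℝ`,
which is closed for pointwise convergence. -/
theorem exists_polynomial_of_tendsto {k : ℕ} {f : ℕ → ℝ → ℝ} {g : ℝ → ℝ}
    (hf : ∀ n, ∃ p ∈ Polynomial.degreeLT ℝ k, ∀ x, f n x = p.eval x)
    (hfg : ∀ x, Tendsto (fun n => f n x) atTop (𝓝 (g x))) :
    ∃ p : Polynomial ℝ, ∀ x, g x = p.eval x := by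
  let P : Submodule ℝ (ℝ → ℝ) :=
    (Polynomial.degreeLT ℝ k).map (LinearMap.pi fun x : ℝ => Polynomial.leval x)
  have : FiniteDimensional ℝ (Polynomial.degreeLT ℝ k) :=
    (Polynomial.degreeLTEquiv ℝ k).symm.finiteDimensional
  have hclosed : IsClosed (P : Set (ℝ → ℝ)) := Submodule.closed_of_finiteDimensional P
  have hmem : g ∈ P := by
    refine hclosed.mem_of_tendsto (tendsto_pi_nhds.2 hfg) (Eventually.of_forall fun n => ?_)
    obtain ⟨p, hp, hfp⟩ := hf n
    exact ⟨p, hp, funext fun x => (hfp x).symm⟩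
  obtain ⟨p, -, hp⟩ := hmem
  exact ⟨p, fun x => congrFun hp.symm x⟩

/-! ### Density of ridge functions -/

theorem integral_mem_of_isClosed {X : Type*} [NormedAddCommGroup X] [NormedSpace ℝ X]
    [CompleteSpace X] {M : Submodule ℝ X} (hM : IsClosed (M : Set X)) {c : ℝ → X}
    (hc : Continuous c) (hs : HasCompactSupport c) (h : ∀ t, c t ∈ M) : ∫ t, c t ∈ M := by
  have : CompleteSpace M := hM.completeSpace_coe
  let d : ℝ → M := fun t => ⟨c t, h t⟩
  have hd : Continuous d := hc.subtype_mk h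
  have hds : HasCompactSupport d := hs.mono fun t ht h0 => ht (Subtype.ext h0)
  have hcomm := ContinuousLinearMap.integral_comp_comm M.subtypeL
    (hd.integrable_of_hasCompactSupport (μ := MeasureTheory.volume) hds)
  change ∫ t, M.subtypeL (d t) ∈ M
  rw [hcomm]
  exact (∫ t, d t).2

section Ridge

variable {K : Type*} [TopologicalSpace K] [CompactSpace K]

/-- The uniform closure of the span of the functions `σ ∘ (u + b)`, where `u` runs over a space
`E` of continuous functions on `K` and `b` over the real constants. For `E` the restrictions of
linear functionals to `K`, these are the scalar networks without output bias. -/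
def ridgeClosure (σ : C(ℝ, ℝ)) (E : Submodule ℝ C(K, ℝ)) : Submodule ℝ C(K, ℝ) :=
  (Submodule.span ℝ
    {f | ∃ u ∈ E, ∃ b : ℝ, f = σ.comp (u + ContinuousMap.const K b)}).topologicalClosure

theorem comp_mem_ridgeClosure (σ : C(ℝ, ℝ)) {E : Submodule ℝ C(K, ℝ)} {u : C(K, ℝ)} (hu : u ∈ E)
    (b : ℝ) : σ.comp (u + ContinuousMap.const K b) ∈ ridgeClosure σ E :=
  Submodule.le_topologicalClosure _ (Submodule.subset_span ⟨u, hu, b, rfl⟩)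

/-- If the curve `s ↦ w * f ∘ (s • u + b)` stays in a closed subspace, so does its derivative. -/
theorem mul_comp_deriv_mem {M : Submodule ℝ C(K, ℝ)} (hM : IsClosed (M : Set C(K, ℝ)))
    {f f' : C(ℝ, ℝ)} (hf : ∀ x, HasDerivAt f (f' x) x) (u w : C(K, ℝ)) (b : ℝ)
    (hmem : ∀ s : ℝ, w * f.comp (s • u + ContinuousMap.const K b) ∈ M) (s : ℝ) :
    w * u * f'.comp (s • u + ContinuousMap.const K b) ∈ M := by
  have hmain : w * u * f'.comp (s • u + ContinuousMap.const K b) ∈ closure (M : Set C(K, ℝ)) := by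
    rw [Metric.mem_closure_iff]
    intro ε hε
    have hd : Continuous fun r : ℝ => w * u * f'.comp (r • u + ContinuousMap.const K b) := by
      fun_prop
    obtain ⟨δ, hδ, hball⟩ := Metric.continuous_iff.1 hd s ε hε
    refine ⟨(δ / 2)⁻¹ • (w * f.comp ((s + δ / 2) • u + ContinuousMap.const K b) -
      w * f.comp (s • u + ContinuousMap.const K b)),
      M.smul_mem _ (M.sub_mem (hmem _) (hmem _)), ?_⟩
    rw [dist_comm, ContinuousMap.dist_lt_iff hε]
    intro v
    -- the difference quotient at `v` is the derivative at an intermediate parameter `ξ`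
    have hderiv (r : ℝ) : HasDerivAt (fun r : ℝ => w v * f (r * u v + b))
        (w v * (f' (r * u v + b) * u v)) r := by
      have h1 : HasDerivAt (fun r : ℝ => r * u v + b) (u v) r := by
        simpa using ((hasDerivAt_id r).mul_const (u v)).add_const b
      exact ((hf _).comp r h1).const_mul (w v)
    obtain ⟨ξ, hξ, hslope⟩ := exists_hasDerivAt_eq_slope (fun r : ℝ => w v * f (r * u v + b))
      (fun r => w v * (f' (r * u v + b) * u v)) (show s < s + δ / 2 by linarith)
      (fun r _ => (hderiv r).continuousAt.continuousWithinAt) (fun r _ => hderiv r)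
    have hdist := (ContinuousMap.dist_lt_iff hε).1 (hball ξ (by
      rw [Real.dist_eq, abs_of_pos (by linarith [hξ.1])]; linarith [hξ.2])) v
    have heq : ((δ / 2)⁻¹ • (w * f.comp ((s + δ / 2) • u + ContinuousMap.const K b) -
        w * f.comp (s • u + ContinuousMap.const K b))) v =
        (w * u * f'.comp (ξ • u + ContinuousMap.const K b)) v := by
      simp only [ContinuousMap.smul_apply, ContinuousMap.sub_apply, ContinuousMap.mul_apply,
        ContinuousMap.comp_apply, ContinuousMap.add_apply, ContinuousMap.const_apply, smul_eq_mul]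
      rw [mul_assoc, mul_comm (u v), hslope, add_sub_cancel_left, div_eq_inv_mul (_ - _) (δ / 2)]
    rw [heq]
    exact hdist
  exact hM.closure_subset hmain

/-- The derivatives of all orders of `s ↦ f ∘ (s • u + b)` stay in `M`. The hypothesis and the
conclusion describe members of `M` by their values, which avoids bundling `f` and its derivatives as
continuous maps. -/
theorem pow_mul_iteratedDeriv_comp_mem {M : Submodule ℝ C(K, ℝ)} (hM : IsClosed (M : Set C(K, ℝ)))
    {f : ℝ → ℝ} (hf : ContDiff ℝ (⊤ : ℕ∞) f) (u : C(K, ℝ)) (b : ℝ)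
    (hmem : ∀ (g : C(K, ℝ)) (s : ℝ), (∀ v, g v = f (s * u v + b)) → g ∈ M) (k : ℕ) :
    ∀ (g : C(K, ℝ)) (s : ℝ), (∀ v, g v = u v ^ k * iteratedDeriv k f (s * u v + b)) → g ∈ M := by
  have hcont (k : ℕ) : Continuous (iteratedDeriv k f) :=
    hf.continuous_iteratedDeriv k (by exact_mod_cast le_top)
  induction k with
  | zero => simpa using hmem
  | succ k ih =>
    intro g s hg
    have := mul_comp_deriv_mem hM (f := ⟨_, hcont k⟩) (f' := ⟨_, hcont (k + 1)⟩) (fun x => by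
      have hd : Differentiable ℝ (iteratedDeriv k f) :=
        hf.differentiable_iteratedDeriv k (by exact_mod_cast ENat.natCast_lt_top k)
      have := (hd x).hasDerivAt
      rwa [← iteratedDeriv_succ] at this) u (u ^ k) b (fun r => ih _ r fun v => by simp) s
    convert this using 1
    ext v
    simp [hg, pow_succ]

/-- The `k`-th derivative of `s ↦ f ∘ (s • u + b)` at `s = 0` is `f⁽ᵏ⁾(b) • u ^ k`. -/
theorem pow_mem_of_iteratedDeriv_ne_zero {M : Submodule ℝ C(K, ℝ)}
    (hM : IsClosed (M : Set C(K, ℝ))) {f : ℝ → ℝ} (hf : ContDiff ℝ (⊤ : ℕ∞) f) (u : C(K, ℝ)) (b : ℝ)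
    (hmem : ∀ (g : C(K, ℝ)) (s : ℝ), (∀ v, g v = f (s * u v + b)) → g ∈ M) (k : ℕ)
    (hb : iteratedDeriv k f b ≠ 0) : u ^ k ∈ M := by
  have := pow_mul_iteratedDeriv_comp_mem hM hf u b hmem k (iteratedDeriv k f b • u ^ k) 0
    fun v => by simp [mul_comm]
  exact (M.smul_mem_iff hb).1 this

/-- `(φ ⋆ σ) ∘ u` is the integral of the `C(K, ℝ)`-valued function `t ↦ φ t • σ ∘ (u - t)`. -/
theorem convolution_comp_mem {M : Submodule ℝ C(K, ℝ)} (hM : IsClosed (M : Set C(K, ℝ)))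
    (σ : C(ℝ, ℝ)) {φ : ℝ → ℝ} (hφ : Continuous φ) (hφs : HasCompactSupport φ) (u : C(K, ℝ))
    (hmem : ∀ t : ℝ, σ.comp (u + ContinuousMap.const K t) ∈ M) (g : C(K, ℝ))
    (hg : ∀ v, g v = MeasureTheory.convolution φ σ (ContinuousLinearMap.lsmul ℝ ℝ)
      MeasureTheory.volume (u v)) : g ∈ M := by
  have hc : Continuous fun t : ℝ => φ t • σ.comp (u + ContinuousMap.const K (-t)) :=
    hφ.smul (by fun_prop)
  have hcs : HasCompactSupport fun t : ℝ => φ t • σ.comp (u + ContinuousMap.const K (-t)) :=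
    hφs.smul_right
  have heq : g = ∫ t, φ t • σ.comp (u + ContinuousMap.const K (-t)) := by
    ext v
    rw [ContinuousMap.integral_apply (hc.integrable_of_hasCompactSupport hcs), hg,
      MeasureTheory.convolution_def]
    simp [sub_eq_add_neg]
  rw [heq]
  exact integral_mem_of_isClosed hM hc hcs fun t => M.smul_mem _ (hmem _)

/-- Otherwise all mollifications of `σ` would have vanishing `k`-th derivative, and `σ` would be a
polynomial. -/
theorem pow_mem_ridgeClosure {σ : C(ℝ, ℝ)} (hσ : ¬ ∃ p : Polynomial ℝ, ∀ t, σ t = p.eval t)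
    {E : Submodule ℝ C(K, ℝ)} {u : C(K, ℝ)} (hu : u ∈ E) (k : ℕ) :
    u ^ k ∈ ridgeClosure σ E := by
  by_contra hk
  apply hσ
  have hM : IsClosed (ridgeClosure σ E : Set C(K, ℝ)) :=
    Submodule.isClosed_topologicalClosure _
  let φ (n : ℕ) : ContDiffBump (0 : ℝ) :=
    ⟨1 / ((n : ℝ) + 1) / 2, 1 / ((n : ℝ) + 1), by positivity, half_lt_self (by positivity)⟩
  let f (n : ℕ) : ℝ → ℝ := MeasureTheory.convolution ((φ n).normed MeasureTheory.volume) σ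
    (ContinuousLinearMap.lsmul ℝ ℝ) MeasureTheory.volume
  have hf (n : ℕ) : ContDiff ℝ (⊤ : ℕ∞) (f n) :=
    (φ n).hasCompactSupport_normed.contDiff_convolution_left _ (φ n).contDiff_normed
      σ.continuous.locallyIntegrable
  refine exists_polynomial_of_tendsto (k := k) (f := f) (fun n => ?_) fun x =>
    ContDiffBump.convolution_tendsto_right_of_continuous tendsto_one_div_add_atTop_nhds_zero_nat
      σ.continuous x
  refine exists_polynomial_of_iteratedDeriv_eq_zero k (hf n) fun b => ?_
  by_contra hb
  refine hk (pow_mem_of_iteratedDeriv_ne_zero hM (hf n) u b (fun g s hg => ?_) k hb)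
  refine convolution_comp_mem hM σ (φ n).continuous_normed (φ n).hasCompactSupport_normed
    (s • u + ContinuousMap.const K b) (fun t => ?_) g fun v => by simpa using hg v
  have := comp_mem_ridgeClosure σ (E.smul_mem s hu) (b + t)
  convert this using 2
  ext v
  simp [add_assoc]

/-- The exponentials of `E` lie in `M` by their power series, and as `E` is a subspace they form a
multiplicative monoid, so that the Stone–Weierstrass theorem applies to their span. -/
theorem eq_top_of_pow_mem {M E : Submodule ℝ C(K, ℝ)} (hM : IsClosed (M : Set C(K, ℝ)))
    (hsep : ∀ x y : K, x ≠ y → ∃ u ∈ E, u x ≠ u y) (hpow : ∀ u ∈ E, ∀ k : ℕ, u ^ k ∈ M) :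
    M = ⊤ := by
  let _ : NormedAlgebra ℚ C(K, ℝ) := NormedAlgebra.restrictScalars ℚ ℝ C(K, ℝ)
  let S : Submonoid C(K, ℝ) :=
    { carrier := NormedSpace.exp '' (E : Set C(K, ℝ))
      one_mem' := ⟨0, E.zero_mem, NormedSpace.exp_zero⟩
      mul_mem' := by
        rintro _ _ ⟨u, hu, rfl⟩ ⟨w, hw, rfl⟩
        exact ⟨u + w, E.add_mem hu hw, NormedSpace.exp_add⟩ }
  have hexp (u : C(K, ℝ)) (x : K) : NormedSpace.exp u x = Real.exp (u x) := by
    rw [Real.exp_eq_exp_ℝ]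
    exact NormedSpace.map_exp (ContinuousMap.evalAlgHom ℝ ℝ x) (continuous_eval_const x) u
  have hS : (S : Set C(K, ℝ)) ⊆ M := by
    rintro _ ⟨u, hu, rfl⟩
    refine hM.mem_of_tendsto (NormedSpace.exp_series_hasSum_exp' (𝕂 := ℝ) u)
      (Eventually.of_forall fun s => ?_)
    exact M.sum_mem fun k _ => M.smul_mem _ (hpow u hu k)
  have hle : Subalgebra.toSubmodule (Algebra.adjoin ℝ (S : Set C(K, ℝ))) ≤ M := by
    rw [Algebra.adjoin_eq_span, Submonoid.closure_eq]
    exact Submodule.span_le.2 hS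
  have htop := ContinuousMap.subalgebra_topologicalClosure_eq_top_of_separatesPoints
    (Algebra.adjoin ℝ (S : Set C(K, ℝ))) fun x y hxy => by
      obtain ⟨u, hu, hne⟩ := hsep x y hxy
      refine ⟨_, ⟨NormedSpace.exp u, Algebra.subset_adjoin ⟨u, hu, rfl⟩, rfl⟩, ?_⟩
      simpa [hexp] using hne
  refine eq_top_iff.2 fun f _ => hM.closure_subset_iff.2 hle ?_
  have : f ∈ (Algebra.adjoin ℝ (S : Set C(K, ℝ))).topologicalClosure := by
    rw [htop]; trivial
  exact this

end Ridge

/-! ### Networks with one hidden layer -/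

section Network

variable {V W : Type*} [AddCommGroup V] [Module ℝ V] [AddCommGroup W] [Module ℝ W] {σ : ℝ → ℝ}

theorem IsNeuralNetwork.zero : IsNeuralNetwork σ (0 : V → W) :=
  ⟨0, 0, 0, 0, 0, fun v => by simp⟩

theorem IsNeuralNetwork.add {f g : V → W} (hf : IsNeuralNetwork σ f) (hg : IsNeuralNetwork σ g) :
    IsNeuralNetwork σ (f + g) := by
  obtain ⟨n, w, b, a, c, hf⟩ := hf
  obtain ⟨m, w', b', a', c', hg⟩ := hg
  refine ⟨n + m, Fin.append w w', Fin.append b b', Fin.append a a', c + c', fun v => ?_⟩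
  simp only [Pi.add_apply, hf, hg, Fin.sum_univ_add, Fin.append_left, Fin.append_right]
  abel

theorem IsNeuralNetwork.sum {ι : Type*} (s : Finset ι) {f : ι → V → W}
    (hf : ∀ i ∈ s, IsNeuralNetwork σ (f i)) : IsNeuralNetwork σ (∑ i ∈ s, f i) :=
  Finset.sum_induction f (IsNeuralNetwork σ) (fun _ _ => IsNeuralNetwork.add) .zero hf

theorem IsNeuralNetwork.map {U : Type*} [AddCommGroup U] [Module ℝ U] {f : V → W}
    (hf : IsNeuralNetwork σ f) (L : W →ₗ[ℝ] U) : IsNeuralNetwork σ fun v => L (f v) := by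
  obtain ⟨n, w, b, a, c, hf⟩ := hf
  exact ⟨n, w, b, fun i => L (a i), L c, fun v => by simp [hf]⟩

theorem IsNeuralNetwork.neuron (ℓ : V →ₗ[ℝ] ℝ) (b : ℝ) :
    IsNeuralNetwork σ fun v => σ (ℓ v + b) :=
  ⟨1, fun _ => ℓ, fun _ => b, fun _ => 1, 0, fun v => by simp⟩

end Network

theorem IsNeuralNetwork.continuous {V W : Type*} [NormedAddCommGroup V] [NormedSpace ℝ V]
    [FiniteDimensional ℝ V] [NormedAddCommGroup W] [NormedSpace ℝ W] {σ : ℝ → ℝ}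
    (hσ : Continuous σ) {f : V → W} (hf : IsNeuralNetwork σ f) : Continuous f := by
  obtain ⟨n, w, b, a, c, hf⟩ := hf
  have hw (i) : Continuous (w i) := (w i).continuous_of_finiteDimensional
  rw [funext hf]
  fun_prop

theorem exists_isNeuralNetwork_real {K V : Type*} [TopologicalSpace K] [CompactSpace K]
    [NormedAddCommGroup V] [NormedSpace ℝ V] [FiniteDimensional ℝ V] {ι : K → V}
    (hι : Continuous ι) (hinj : Function.Injective ι) {σ : ℝ → ℝ} (hσ : IsActivation σ)
    (f : C(K, ℝ)) {ε : ℝ} (hε : 0 < ε) :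
    ∃ N : V → ℝ, IsNeuralNetwork σ N ∧ ∀ x, ‖f x - N (ι x)‖ < ε := by
  let E : Submodule ℝ C(K, ℝ) :=
    LinearMap.range ({ toFun := fun ℓ : StrongDual ℝ V => ⟨fun x => ℓ (ι x), by fun_prop⟩
                       map_add' := fun _ _ => rfl
                       map_smul' := fun _ _ => rfl } : StrongDual ℝ V →ₗ[ℝ] C(K, ℝ))
  have htop : ridgeClosure ⟨σ, hσ.1⟩ E = ⊤ := by
    refine eq_top_of_pow_mem (E := E) (Submodule.isClosed_topologicalClosure _)
      (fun x y hxy => ?_) fun u hu k => pow_mem_ridgeClosure hσ.2 hu k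
    obtain ⟨ℓ, hℓ⟩ := SeparatingDual.exists_separating_of_ne (R := ℝ) (hinj.ne hxy)
    exact ⟨_, ⟨ℓ, rfl⟩, hℓ⟩
  have hf : f ∈ ridgeClosure ⟨σ, hσ.1⟩ E := htop ▸ Submodule.mem_top
  obtain ⟨g, hg, hfg⟩ := Metric.mem_closure_iff.1 hf ε hε
  have hnet : ∃ N : V → ℝ, IsNeuralNetwork σ N ∧ ∀ x, g x = N (ι x) := by
    refine Submodule.span_induction ?_ ⟨0, .zero, fun x => rfl⟩ ?_ ?_ hg
    · rintro _ ⟨_, ⟨ℓ, rfl⟩, b, rfl⟩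
      exact ⟨_, IsNeuralNetwork.neuron (ℓ : V →ₗ[ℝ] ℝ) b, fun x => rfl⟩
    · rintro _ _ _ _ ⟨N, hN, hx⟩ ⟨N', hN', hy⟩
      exact ⟨N + N', hN.add hN', fun x => by simp [hx, hy]⟩
    · rintro r _ _ ⟨N, hN, hx⟩
      exact ⟨_, hN.map (LinearMap.lsmul ℝ ℝ r), fun x => by simp [hx]⟩
  obtain ⟨N, hN, hx⟩ := hnet
  refine ⟨N, hN, fun x => ?_⟩
  rw [← hx, ← dist_eq_norm]
  exact (ContinuousMap.dist_lt_iff hε).1 hfg x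

/-- The universal approximation theorem for a compact space `K` embedded in `V` by `ι`. -/
theorem exists_isNeuralNetwork {K V W : Type*} [TopologicalSpace K] [CompactSpace K]
    [NormedAddCommGroup V] [NormedSpace ℝ V] [FiniteDimensional ℝ V]
    [NormedAddCommGroup W] [NormedSpace ℝ W] [FiniteDimensional ℝ W] {ι : K → V}
    (hι : Continuous ι) (hinj : Function.Injective ι) {σ : ℝ → ℝ} (hσ : IsActivation σ)
    (f : C(K, W)) {ε : ℝ} (hε : 0 < ε) :
    ∃ N : V → W, IsNeuralNetwork σ N ∧ ∀ x, ‖f x - N (ι x)‖ < ε := by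
  let B := Module.finBasis ℝ W
  have hcoord (j) : Continuous (B.coord j) := (B.coord j).continuous_of_finiteDimensional
  -- errors of at most `η` in the coordinates add up to at most `η * C`, so `η = ε / (C + 1)` will do
  let C := ∑ j, ‖B j‖
  have hC : 0 ≤ C := Finset.sum_nonneg fun j _ => norm_nonneg _
  have hη : 0 < ε / (C + 1) := by positivity
  choose N hN hNf using fun j =>
    exists_isNeuralNetwork_real hι hinj hσ ⟨fun x => B.coord j (f x), by fun_prop⟩ hη
  refine ⟨∑ j, fun v => N j v • B j, .sum _ fun j _ => (hN j).map (LinearMap.toSpanSingleton ℝ W _),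
    fun x => ?_⟩
  calc ‖f x - (∑ j, fun v => N j v • B j) (ι x)‖
      = ‖∑ j, (B.coord j (f x) - N j (ι x)) • B j‖ := by
        simp only [Finset.sum_apply, sub_smul, Finset.sum_sub_distrib, Module.Basis.coord_apply,
          B.sum_repr]
    _ ≤ ∑ j, ε / (C + 1) * ‖B j‖ := by
        refine norm_sum_le_of_le _ fun j _ => ?_
        rw [norm_smul]
        exact mul_le_mul_of_nonneg_right (hNf j x).le (norm_nonneg _)
    _ = ε * (C / (C + 1)) := by rw [← Finset.mul_sum]; ring
    _ < ε := mul_lt_of_lt_one_right hε ((div_lt_one (by positivity)).2 (by linarith))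

/-! ### The observed system -/

namespace SensorSystem

variable {dξ dx dμ Ns dₒ : ℕ} {X : Type*} [NormedAddCommGroup X] [NormedSpace ℝ X]
  {S : SensorSystem dξ dx dμ Ns dₒ X} {k : ℕ}

theorem isCompact_stateSet (h : IsCompact S.augSet) : IsCompact S.stateSet :=
  h.image (WithLp.continuous_snd 1 _ _)

theorem endState_mem_stateSet {a : AugState dμ X} (ha : a ∈ S.augSet) :
    S.endState k a ∈ S.stateSet :=
  ⟨WithLp.toLp 1 (a.fst, S.endState k a), ⟨ha.1, (S.mapsTo_inv _ ha.1).iterate k ha.2⟩, rfl⟩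

theorem StableDelayObservable.isCompact_windowSet (hobs : S.StableDelayObservable k)
    (h : IsCompact S.augSet) : IsCompact (S.windowSet k) := by
  obtain ⟨C, hC, -, -, -, hlip, -⟩ := hobs
  have : LipschitzOnWith ⟨C, hC.le⟩ (S.delayMap k) S.augSet :=
    LipschitzOnWith.of_dist_le_mul fun a ha b hb => by
      rw [dist_eq_norm, dist_eq_norm]
      exact hlip a ha b hb
  exact h.image_of_continuousOn this.continuousOn

theorem StableDelayObservable.continuous_delayInverse (hobs : S.StableDelayObservable k) :
    Continuous (S.delayInverse k) := by
  obtain ⟨-, -, C, hC, -, -, hlip⟩ := hobs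
  have : LipschitzWith ⟨C, hC.le⟩ (S.delayInverse k) :=
    LipschitzWith.of_dist_le_mul fun y y' => by
      rw [Subtype.dist_eq, Subtype.dist_eq, dist_eq_norm, dist_eq_norm]
      exact hlip y y'
  exact this.continuous

end SensorSystem

/-! ### Approximation of a composition -/

/-- Uniform continuity of `f` in its second argument near the compact set `s ×ˢ t`; the
point `z'` need not lie in `t`. -/
theorem exists_delta_near_isCompact {E F W : Type*} [PseudoMetricSpace E] [PseudoMetricSpace F]
    [PseudoMetricSpace W] {f : E × F → W} (hf : Continuous f) {s : Set E} {t : Set F}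
    (hs : IsCompact s) (ht : IsCompact t) {ε : ℝ} (hε : 0 < ε) :
    ∃ δ > 0, ∀ x ∈ s, ∀ z ∈ t, ∀ z', dist z z' < δ → dist (f (x, z)) (f (x, z')) < ε := by
  obtain ⟨δ, hδ, h⟩ := Metric.mem_uniformity_dist.1 ((hs.prod ht).uniformContinuousAt_of_continuousAt
    f (fun _ _ => hf.continuousAt) (Metric.dist_mem_uniformity hε))
  refine ⟨δ, hδ, fun x hx z hz z' hzz' => ?_⟩
  refine h (a := (x, z)) (b := (x, z')) ?_ ⟨hx, hz⟩
  simpa [Prod.dist_eq, hδ] using hzz'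

/-- Networks for `D` and `G` whose composition also approximates `D (ξ, G y)`, although `Gn y`
may leave `Z`. -/
theorem exists_isNeuralNetwork_comp {dz dx dξ : ℕ} {V : Type*} [NormedAddCommGroup V]
    [NormedSpace ℝ V] [FiniteDimensional ℝ V] {Y : Set V} (hY : IsCompact Y)
    {Ω : Set (EuclideanSpace ℝ (Fin dξ))} (hΩ : IsCompact Ω)
    {Z : Set (EuclideanSpace ℝ (Fin dz))} (hZ : IsCompact Z)
    (G : C(Y, Z)) (D : C(Ω × Z, EuclideanSpace ℝ (Fin dx)))
    {σ : ℝ → ℝ} (hσ : IsActivation σ) {ε : ℝ} (hε : 0 < ε) :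
    ∃ (Gn : V → EuclideanSpace ℝ (Fin dz))
      (Dn : EuclideanSpace ℝ (Fin dξ) × EuclideanSpace ℝ (Fin dz) → EuclideanSpace ℝ (Fin dx)),
      IsNeuralNetwork σ Gn ∧ IsNeuralNetwork σ Dn ∧
      (∀ y : Y, ‖(G y : EuclideanSpace ℝ (Fin dz)) - Gn y‖ < ε) ∧
      (∀ (ξ : Ω) (z : Z), ‖D (ξ, z) - Dn (ξ, z)‖ < ε) ∧
      ∀ (y : Y) (ξ : Ω), ‖D (ξ, G y) - Dn (ξ, Gn y)‖ < ε := by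
  have := isCompact_iff_compactSpace.1 hY
  have := isCompact_iff_compactSpace.1 hΩ
  have := isCompact_iff_compactSpace.1 hZ
  obtain ⟨Dn, hDn, hD⟩ := exists_isNeuralNetwork
    (ι := fun p : Ω × Z => ((p.1 : EuclideanSpace ℝ (Fin dξ)), (p.2 : EuclideanSpace ℝ (Fin dz))))
    (by fun_prop) (Subtype.val_injective.prodMap Subtype.val_injective) hσ D (half_pos hε)
  obtain ⟨δ, hδ, hDδ⟩ := exists_delta_near_isCompact (hDn.continuous hσ.1) hΩ hZ (half_pos hε)
  obtain ⟨Gn, hGn, hG⟩ := exists_isNeuralNetwork (ι := ((↑) : Y → V)) continuous_subtype_val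
    Subtype.val_injective hσ
    ⟨fun y => (G y : EuclideanSpace ℝ (Fin dz)), by fun_prop⟩ (lt_min hδ hε)
  refine ⟨Gn, Dn, hGn, hDn, fun y => (hG y).trans_le (min_le_right _ _),
    fun ξ z => (hD (ξ, z)).trans (half_lt_self hε), fun y ξ => ?_⟩
  have h1 := hD (ξ, G y)
  have h2 := hDδ ξ ξ.2 (G y) (G y).2 (Gn y)
    (by rw [dist_eq_norm]; exact (hG y).trans_le (min_le_left _ _))
  rw [dist_eq_norm] at h2
  calc ‖D (ξ, G y) - Dn (ξ, Gn y)‖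
      ≤ ‖D (ξ, G y) - Dn (ξ, G y)‖ + ‖Dn (ξ, G y) - Dn (ξ, Gn y)‖ :=
        norm_sub_le_norm_sub_add_norm_sub _ _ _
    _ < ε := by linarith

/-- The bound `ε / 2` keeps the supremum, which need not be attained, strictly below `ε`. -/
theorem iSup_enorm_lt_ofReal {ι W : Type*} [SeminormedAddCommGroup W] {f : ι → W} {ε : ℝ}
    (hε : 0 < ε) (h : ∀ i, ‖f i‖ < ε / 2) : ⨆ i, ‖f i‖ₑ < ENNReal.ofReal ε := by
  refine lt_of_le_of_lt (iSup_le fun i => ?_)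
    ((ENNReal.ofReal_lt_ofReal_iff hε).2 (half_lt_self hε))
  rw [← ofReal_norm]
  exact ENNReal.ofReal_le_ofReal (h i).le

theorem iSup₂_enorm_lt_ofReal {ι κ W : Type*} [SeminormedAddCommGroup W] {f : ι → κ → W} {ε : ℝ}
    (hε : 0 < ε) (h : ∀ i j, ‖f i j‖ < ε / 2) : ⨆ (i) (j), ‖f i j‖ₑ < ENNReal.ofReal ε := by
  have := iSup_enorm_lt_ofReal hε fun p : ι × κ => h p.1 p.2
  rwa [iSup_prod] at this

/-! ### Reconstruction through a latent space -/

theorem theorem1 {dξ dx dμ Ns dₒ : ℕ} {X : Type*} [NormedAddCommGroup X] [NormedSpace ℝ X]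
    [CompleteSpace X] (S : SensorSystem dξ dx dμ Ns dₒ X) (k : ℕ)
    (hcompact : IsCompact S.augSet) (hdim : boxDim S.augSet < ⊤)
    (hobs : S.StableDelayObservable k)
    (hcont : ContinuousOn (S.endState k) S.augSet)
    (dz : ℕ) (hdz : 2 * boxDim S.stateSet < (dz : EReal)) :
    ∃ Z : Set (EuclideanSpace ℝ (Fin dz)), IsCompact Z ∧
      ∃ (G : C(S.windowSet k, Z)) (D : C(S.Ω × Z, EuclideanSpace ℝ (Fin dx))),
        (∀ (y : S.windowSet k) (ξ : S.Ω), S.reconstruct k y ξ = D (ξ, G y)) ∧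
        ∀ σ : ℝ → ℝ, IsActivation σ → ∀ ε : ℝ, 0 < ε →
          ∃ (Gn : SensorSystem.Window Ns dₒ k → EuclideanSpace ℝ (Fin dz))
            (Dn : EuclideanSpace ℝ (Fin dξ) × EuclideanSpace ℝ (Fin dz) →
              EuclideanSpace ℝ (Fin dx)),
            IsNeuralNetwork σ Gn ∧ IsNeuralNetwork σ Dn ∧
            (⨆ y : S.windowSet k, ‖(G y : EuclideanSpace ℝ (Fin dz)) - Gn y‖ₑ)
              < ENNReal.ofReal ε ∧
            (⨆ (ξ : S.Ω) (z : Z), ‖D (ξ, z) - Dn (ξ, z)‖ₑ) < ENNReal.ofReal ε ∧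
            (⨆ (y : S.windowSet k) (ξ : S.Ω), ‖S.reconstruct k y ξ - Dn (ξ, Gn y)‖ₑ)
              < ENNReal.ofReal ε := by

  have hA := SensorSystem.isCompact_stateSet hcompact
  obtain ⟨L, hL⟩ := exists_continuousLinearMap_injOn (W := EuclideanSpace ℝ (Fin dz)) hA
    (by rwa [finrank_euclideanSpace_fin])
  have hZ : IsCompact (L '' S.stateSet) := hA.image L.continuous
  have := isCompact_iff_compactSpace.1 hA
  have := isCompact_iff_compactSpace.1 S.isCompact_Ω
  let e : S.stateSet ≃ₜ L '' S.stateSet :=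
    Continuous.homeoOfEquivCompactToT2 (f := Equiv.Set.imageOfInjOn L S.stateSet hL)
      ((L.continuous.comp continuous_subtype_val).subtype_mk _)
  let R : S.windowSet k → S.stateSet := fun y =>
    ⟨S.endState k (S.delayInverse k y),
      SensorSystem.endState_mem_stateSet (S.delayInverse k y).2⟩
  have hR : Continuous R :=
    (hcont.domRestrict.comp hobs.continuous_delayInverse).subtype_mk _
  let G : C(S.windowSet k, L '' S.stateSet) := ⟨fun y => e (R y), e.continuous.comp hR⟩
  let D : C(S.Ω × (L '' S.stateSet), EuclideanSpace ℝ (Fin dx)) :=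
    ⟨fun p => S.embed (e.symm p.2) p.1, by fun_prop⟩
  have hGD (y : S.windowSet k) (ξ : S.Ω) : S.reconstruct k y ξ = D (ξ, G y) := by
    simp [D, G, R, SensorSystem.reconstruct]
  clear_value G D
  refine ⟨L '' S.stateSet, hZ, G, D, hGD, fun σ hσ ε hε => ?_⟩
  obtain ⟨Gn, Dn, hGn, hDn, h1, h2, h3⟩ := exists_isNeuralNetwork_comp
    (hobs.isCompact_windowSet hcompact) S.isCompact_Ω hZ G D hσ (half_pos hε)
  simp only [hGD]
  exact ⟨Gn, Dn, hGn, hDn, iSup_enorm_lt_ofReal hε h1, iSup₂_enorm_lt_ofReal hε h2,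
    iSup₂_enorm_lt_ofReal hε h3⟩
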